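/- A ternary tree is a rooted ordered tree in which every vertex has either $0$ or exactly $3$ (ordered) children; ternary trees also serve as patterns. Write $\bullet$ for the single-vertex tree and $t_{3_1}$ for the three-leaf tree. A tree $p\neq\bullet$ has left, center and right subtrees $p_\ell,p_c,p_r$. A tree $T$ contains $p$ at its root if it has a copy of $p$, as a contiguous ordered subtree, whose root is the root of $T$; $T$ contains $t$ if it has such a copy beginning at some vertex of $T$, and otherwise $T$ avoids $t$. The intersection $s\cap t$ of patterns is defined by $s\cap\bullet=s$, $\bullet\cap t=t$, and, for $s,t\ne\bullet$, as the tree whose left, center and right subtrees are $s_\ell\cap t_\ell$, $s_c\cap t_c$, $s_r\cap t_r$. Let $g_t(x)=\sum_{n\ge 0}a_nx^n\in\mathbb{Q}[[x]]$, where $a_n$ is the number of $n$-leaf ternary trees that avoid $t$, and let $g_{(t;p)}(x)$ be the corresponding generating function for the trees that avoid $t$ and contain $p$ at their root. Let $t\neq\bullet$ be a ternary tree pattern. Then: (1) $g_t=g_{(t;\bullet)}=x+g_{(t;t_{3_1})}$. (2) For every ternary tree pattern $p\neq\bullet$, $$g_{(t;p)}=g_{(t;p_\ell)}\,g_{(t;p_c)}\,g_{(t;p_r)}-g_{(t;p_\ell\cap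 t_\ell)}\,g_{(t;p_c\cap t_c)}\,g_{(t;p_r\cap t_r)}.$$ (3) Consider the following algorithm. Start with the equation $g_{(t;\bullet)}=x+g_{(t;t_{3_1})}$ in $\mathrm{Eq}$, with $\mathrm{Var}=\{\bullet\}$ and $P=\{t_{3_1}\}$. In each round, add to $\mathrm{Eq}$ the equation in (2) for every $p\in P$, replace $\mathrm{Var}$ by $\mathrm{Var}\cup P$, and then let the new $P$ be the set of all patterns $p_\ell,p_c,p_r,p_\ell\cap t_\ell,p_c\cap t_c,p_r\cap t_r$, with $p$ in the old $P$, that do not lie in the new $\mathrm{Var}$; stop when $P=\emptyset$. This algorithm stops after finitely many rounds. It yields a finite system $\mathrm{Eq}$ of polynomial equations over $\mathbb{Q}$ in $x$ and the unknowns $g_{(t;p)}$, each of total degree at most $3$ and each satisfied by the generating functions. The system is complete: every unknown that occurs in it is some $g_{(t;p)}$ with $p\in\mathrm{Var}$, and for every $p\in\mathrm{Var}$ the equation defining $g_{(t;p)}$ (the initial equation if $p=\bullet$, the equation in (2) if $p\ne\bullet$) belongs to $\mathrm{Eq}$. Moreover, for every ternary tree pattern $t$ (including $t=\bullet$), the power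 series $g_t(x)$ is algebraic: there is a nonzero polynomial $F(x,y)\in\mathbb{Q}[x,y]$ with $F(x,g_t(x))=0$. -/

import Mathlib

/-- Ternary trees: rooted ordered trees in which every vertex has either no child or exactly three
(ordered) children. They serve both as trees and as tree patterns. -/
inductive TernaryTree : Type where
  | leaf : TernaryTree
  | node (l c r : TernaryTree) : TernaryTree
  deriving DecidableEq

namespace TernaryTree

/-- The number of leaves (vertices without children). -/
def numLeaves : TernaryTree → ℕ
  | leaf => 1
  | node l c r => l.numLeaves + c.numLeaves + r.numLeaves

/-- Left subtree (only meaningful for trees other than the single vertex). -/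
def left : TernaryTree → TernaryTree
  | leaf => leaf
  | node l _ _ => l

/-- Center subtree (only meaningful for trees other than the single vertex). -/
def center : TernaryTree → TernaryTree
  | leaf => leaf
  | node _ c _ => c

/-- Right subtree (only meaningful for trees other than the single vertex). -/
def right : TernaryTree → TernaryTree
  | leaf => leaf
  | node _ _ r => r

/-- The three-leaf tree. -/
def threeLeaf : TernaryTree := node leaf leaf leaf

/-- `T.ContainsAtRoot p`: there is a copy of the pattern `p` in `T`, as a contiguous ordered
subtree, in which the root of `p` coincides with the root of `T`. -/
def ContainsAtRoot : TernaryTree → TernaryTree → Prop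
  | _, leaf => True
  | leaf, node _ _ _ => False
  | node l c r, node l' c' r' =>
      l.ContainsAtRoot l' ∧ c.ContainsAtRoot c' ∧ r.ContainsAtRoot r'

/-- `T.Contains t`: there is a copy of the pattern `t` in `T`, as a contiguous ordered subtree,
beginning at the root of `T` or at some other vertex of `T`. -/
def Contains : TernaryTree → TernaryTree → Prop
  | leaf, t => leaf.ContainsAtRoot t
  | node l c r, t =>
      (node l c r).ContainsAtRoot t ∨ l.Contains t ∨ c.Contains t ∨ r.Contains t

/-- `T` avoids the pattern `t`. -/
def Avoids (T t : TernaryTree) : Prop := ¬ T.Contains t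

/-- The intersection `s ∩ t` of tree patterns: draw `s` and `t` with coinciding roots. -/
def inter : TernaryTree → TernaryTree → TernaryTree
  | leaf, t => t
  | node l c r, leaf => node l c r
  | node l c r, node l' c' r' => node (l.inter l') (c.inter c') (r.inter r')

instance : Inter TernaryTree := ⟨inter⟩

theorem one_le_numLeaves (T : TernaryTree) : 1 ≤ T.numLeaves := by
  induction T with
  | leaf => simp [numLeaves]
  | node l c r hl hc hr => simp only [numLeaves]; omega

/-- There are finitely many ternary trees with `n` leaves, so the cardinalities below are genuine. -/
theorem finite_numLeaves_le (n : ℕ) : {T : TernaryTree | T.numLeaves ≤ n}.Finite := by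
  induction n with
  | zero =>
    refine Set.finite_empty.subset fun T hT => ?_
    have := T.one_le_numLeaves
    simp only [Set.mem_ofPred_eq] at hT
    omega
  | succ n ih =>
    refine ((Set.finite_singleton leaf).union
      ((ih.prod (ih.prod ih)).image fun q => node q.1 q.2.1 q.2.2)).subset fun T hT => ?_
    cases T with
    | leaf => exact Or.inl rfl
    | node l c r =>
      refine Or.inr ⟨(l, c, r), ?_, rfl⟩
      have h1 := l.one_le_numLeaves
      have h2 := c.one_le_numLeaves
      have h3 := r.one_le_numLeaves
      simp only [Set.mem_ofPred_eq, numLeaves] at hT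
      simp only [Set.mem_prod, Set.mem_ofPred_eq]
      omega

/-- The set `Av_t(n)` of `n`-leaf ternary trees that avoid `t`. -/
def Av (t : TernaryTree) (n : ℕ) : Set TernaryTree :=
  {T | T.numLeaves = n ∧ T.Avoids t}

/-- The set of `n`-leaf ternary trees that avoid `t` and contain `p` at their root. -/
def AvRoot (t p : TernaryTree) (n : ℕ) : Set TernaryTree :=
  {T | T.numLeaves = n ∧ T.Avoids t ∧ T.ContainsAtRoot p}

/-- The avoidance generating function `g_t(x)`, as a formal power series. -/
noncomputable def avoidGF (t : TernaryTree) : PowerSeries ℚ :=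
  PowerSeries.mk fun n => ((Av t n).ncard : ℚ)

/-- The generating function `g_{(t;p)}(x)` of the trees that avoid `t` and contain `p` at their
root, as a formal power series. -/
noncomputable def rootGF (t p : TernaryTree) : PowerSeries ℚ :=
  PowerSeries.mk fun n => ((AvRoot t p n).ncard : ℚ)

/-! ### The algorithm

The unknowns of the polynomial system are `none`, which stands for `x`, and `some p`, which stands
for `g_{(t;p)}(x)`. An equation `a = b` is recorded as the polynomial `a - b`. -/

/-- The polynomial ring in `x` and in one unknown for each pattern. -/
abbrev SystemPoly : Type := MvPolynomial (Option TernaryTree) ℚ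

/-- The unknown that stands for `g_{(t;p)}(x)`. -/
noncomputable def unknown (p : TernaryTree) : SystemPoly := MvPolynomial.X (some p)

/-- The equation `g_{(t;•)} = x + g_{(t;threeLeaf)}` with which the algorithm starts. -/
noncomputable def initialEquation : SystemPoly :=
  unknown leaf - (MvPolynomial.X none + unknown threeLeaf)

/-- The equation `g_{(t;p)} = g_{(t;p_ℓ)} g_{(t;p_c)} g_{(t;p_r)}
- g_{(t;p_ℓ∩t_ℓ)} g_{(t;p_c∩t_c)} g_{(t;p_r∩t_r)}`. -/
noncomputable def recurrenceEquation (t p : TernaryTree) : SystemPoly :=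
  unknown p -
    (unknown p.left * unknown p.center * unknown p.right -
      unknown (p.left ∩ t.left) * unknown (p.center ∩ t.center) * unknown (p.right ∩ t.right))

/-- The patterns that occur on the right-hand side of the equation for `g_{(t;p)}`. -/
def successors (t p : TernaryTree) : Finset TernaryTree :=
  {p.left, p.center, p.right, p.left ∩ t.left, p.center ∩ t.center, p.right ∩ t.right}

/-- A state of the algorithm: the equations found so far, the patterns `p` whose unknown
`g_{(t;p)}` has been given an equation, and the patterns to be treated in the next round. -/
structure AlgState where
  Eq : Finset SystemPoly
  Var : Finset TernaryTree
  P : Finset TernaryTree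

/-- The initial state. -/
noncomputable def initState : AlgState where
  Eq := {initialEquation}
  Var := {leaf}
  P := {threeLeaf}

/-- One round: every `p ∈ P` gets its equation and joins `Var`; the next `P` consists of the
patterns introduced by these equations that are not in (the new) `Var`. -/
noncomputable def step (t : TernaryTree) (S : AlgState) : AlgState where
  Eq := S.Eq ∪ S.P.image (recurrenceEquation t)
  Var := S.Var ∪ S.P
  P := S.P.biUnion (successors t) \ (S.Var ∪ S.P)

/-- The state after `k` rounds. -/
noncomputable def stateAfter (t : TernaryTree) (k : ℕ) : AlgState := (step t)^[k] initState

/-- The values at which the system is evaluated: `x` for `none`, `g_{(t;p)}(x)` for `some p`. -/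
noncomputable def systemValue (t : TernaryTree) : Option TernaryTree → PowerSeries ℚ
  | none => PowerSeries.X
  | some p => rootGF t p

end TernaryTree

/-!
For `t ≠ leaf`, a tree `T` avoids `t` and contains `p ≠ leaf` at its root exactly if its three
subtrees avoid `t` and contain `p.left`, `p.center`, `p.right` at their roots, while `T` does not
contain `t` at its root. As a tree contains `s ∩ t` at its root exactly if it contains both `s` and `t` there
(`TernaryTree.containsAtRoot_inter`), counting triples of subtrees gives the recurrence
`TernaryTree.rootGF_recurrence`.

The algorithm only meets patterns of height at most `max 1 t.height`, since passing to subtrees does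
not increase the height and `(s ∩ t).height = max s.height t.height`. There are finitely many of
these, and a round with nonempty `P` adds new ones to `Var`; hence the algorithm stops
(`TernaryTree.exists_stateAfter_P_eq_empty`). Completeness of the final system is an invariant of
the rounds.

Algebraicity follows from the system without elimination. In characteristic zero, finitely many
elements of an extension field are algebraic over the base field as soon as all derivations over the
base field kill them (`isAlgebraic_of_forall_derivation_eq_zero`). Let `d` be a derivation over
`ℚ[x]` with values in a `ℚ⟦x⟧`-module. The generating functions have no constant term, as every tree
has a leaf. Differentiating the recurrence therefore writes each `d g_{(t;p)}` with `p ≠ leaf` as a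
combination of the `d g_{(t;q)}` with coefficients in the maximal ideal of `ℚ⟦x⟧`, and
`d g_{(t;leaf)} = d g_{(t;threeLeaf)}`. By Nakayama's lemma all `d g_{(t;p)}` vanish
(`TernaryTree.isAlgebraic_rootGF`).
-/

/-! ### A differential criterion for algebraicity -/

section DifferentialCriterion

open scoped TensorProduct

universe u

/-- A differential criterion for algebraicity in characteristic zero: the elements of a finite set
`s` are algebraic over `k` if every `k`-derivation from a field containing `s` to a `K`-vector space
vanishes on `s`. Indeed the universal derivation of `L = k(s)`, extended to `K ⊗[L] Ω[L⁄k]`, is such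
a derivation, so `Ω[L⁄k] = 0`, which makes the finitely generated extension `L / k` unramified and
hence separable algebraic. Derivations are given as additive maps with the Leibniz rule, so that
only the module structure over `K` enters. -/
theorem isAlgebraic_of_forall_derivation_eq_zero {k K : Type u} [Field k] [CharZero k] [Field K]
    [Algebra k K] (s : Finset K)
    (h : ∀ (L : IntermediateField k K), (s : Set K) ⊆ L →
      ∀ (M : Type u) [AddCommGroup M] [Module K M] (d : L →+ M),
        (∀ c, d (algebraMap k L c) = 0) → (∀ x y : L, d (x * y) = (x : K) • d y + (y : K) • d x) →
        ∀ x : L, (x : K) ∈ s → d x = 0) :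
    ∀ x ∈ s, IsAlgebraic k x := by
  let L : IntermediateField k K := IntermediateField.adjoin k s
  have hs : (s : Set K) ⊆ L := IntermediateField.subset_adjoin _ _
  have : Algebra.EssFiniteType k L :=
    IntermediateField.essFiniteType_iff.mpr (IntermediateField.fg_adjoin_finset _)
  let D := KaehlerDifferential.D k L
  have hD : ∀ x (hx : x ∈ s), D ⟨x, hs hx⟩ = 0 := by
    intro x hx
    have := h L hs (K ⊗[L] Ω[L⁄k])
      ((TensorProduct.mk L K (Ω[L⁄k]) 1).toAddMonoidHom.comp D.toLinearMap.toAddMonoidHom)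
      (fun c => (congrArg _ (D.map_algebraMap c)).trans (TensorProduct.tmul_zero _ _))
      (fun x y => by
        have hsm : ∀ (z : L) (w : Ω[L⁄k]),
            (1 : K) ⊗ₜ[L] (z • w) = (z : K) • ((1 : K) ⊗ₜ[L] w) := fun z w => by
          rw [← TensorProduct.smul_tmul, TensorProduct.smul_tmul', Algebra.smul_def, smul_eq_mul]
          rfl
        change (1 : K) ⊗ₜ[L] D (x * y) =
          (x : K) • ((1 : K) ⊗ₜ[L] D y) + (y : K) • ((1 : K) ⊗ₜ[L] D x)
        rw [Derivation.leibniz, TensorProduct.tmul_add, hsm, hsm])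
      ⟨x, hs hx⟩ hx
    -- `K` is faithfully flat over the field `L`, so `w ↦ 1 ⊗ w` is injective.
    exact Module.FaithfullyFlat.tensorProduct_mk_injective (A := L) (B := K) (Ω[L⁄k])
      (Eq.trans this (TensorProduct.tmul_zero _ _).symm)
  have hD' : ∀ y (hy : y ∈ L), D ⟨y, hy⟩ = 0 := by
    intro y hy
    induction hy using IntermediateField.adjoin_induction with
    | mem y hy => exact hD y hy
    | algebraMap c => exact D.map_algebraMap c
    | add y z hy hz ihy ihz =>
      exact (D.map_add ⟨y, hy⟩ ⟨z, hz⟩).trans (by rw [ihy, ihz, add_zero])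
    | inv y hy ih => exact (D.leibniz_inv ⟨y, hy⟩).trans (by rw [ih, smul_zero])
    | mul y z hy hz ihy ihz =>
      exact (D.leibniz ⟨y, hy⟩ ⟨z, hz⟩).trans (by rw [ihy, ihz, smul_zero, smul_zero, add_zero])
  -- The universal derivation vanishes on `L`, and its range spans `Ω[L⁄k]`.
  have hΩ : Subsingleton Ω[L⁄k] := by
    refine (Submodule.subsingleton_iff L).mp (subsingleton_of_bot_eq_top ?_)
    rw [← KaehlerDifferential.span_range_derivation k L, eq_comm, Submodule.span_eq_bot]
    rintro _ ⟨y, rfl⟩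
    exact hD' y y.2
  have : Algebra.FormallyUnramified k L := ⟨hΩ⟩
  have : Algebra.IsSeparable k L := Algebra.FormallyUnramified.isSeparable k L
  exact fun x hx => IntermediateField.isAlgebraic_iff.mp
    (Algebra.IsAlgebraic.isAlgebraic (⟨x, hs hx⟩ : L))

/-- The criterion `isAlgebraic_of_forall_derivation_eq_zero` for domains: it suffices to consider
`R`-derivations from subalgebras of `A` to `A`-modules. The point of allowing all `A`-modules is
that Nakayama's lemma applies to them when `A` is local. -/
theorem isAlgebraic_of_forall_subalgebra_derivation_eq_zero {R A : Type u} [CommRing R] [IsDomain R]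
    [CharZero R] [CommRing A] [IsDomain A] [Algebra R A] [FaithfulSMul R A] (s : Finset A)
    (h : ∀ (B : Subalgebra R A), (s : Set A) ⊆ B →
      ∀ (M : Type u) [AddCommGroup M] [Module A M] (d : B →+ M),
        (∀ c, d (algebraMap R B c) = 0) → (∀ x y : B, d (x * y) = (x : A) • d y + (y : A) • d x) →
        ∀ x : B, (x : A) ∈ s → d x = 0) :
    ∀ x ∈ s, IsAlgebraic R x := by
  classical
  let k := FractionRing R
  let K := FractionRing A
  have : FaithfulSMul R K := FaithfulSMul.trans R A K
  let : Algebra k K := FractionRing.liftAlgebra R K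
  have : IsScalarTower R k K := FractionRing.isScalarTower_liftAlgebra R K
  have : CharZero k := IsFractionRing.charZero R
  have hinj := IsFractionRing.injective A K
  have key := isAlgebraic_of_forall_derivation_eq_zero (k := k) (s.image (algebraMap A K)) ?_
  · intro x hx
    have h2 := key _ (Finset.mem_image_of_mem _ hx)
    rw [← IsFractionRing.isAlgebraic_iff R k K] at h2
    exact (isAlgebraic_algebraMap_iff hinj).mp h2
  intro L hL M _ _ d hd0 hd y hy
  -- A derivation of `L` restricts to the preimage `B` of `L` in `A`.
  let B : Subalgebra R A := (L.toSubalgebra.restrictScalars R).comap (IsScalarTower.toAlgHom R A K)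
  let φ : B →+* L := ((algebraMap A K).comp B.val.toRingHom).codRestrict L fun x => x.2
  let : Module A M := Module.compHom M (algebraMap A K)
  have hR : ∀ c : R, φ (algebraMap R B c) = algebraMap k L (algebraMap R k c) := fun c =>
    Subtype.ext ((IsScalarTower.algebraMap_apply R A K c).symm.trans
      (IsScalarTower.algebraMap_apply R k K c))
  obtain ⟨x, hx, hxy⟩ := Finset.mem_image.mp hy
  have hsB : (s : Set A) ⊆ B := fun x hx => hL (Finset.mem_image_of_mem _ hx)
  have := h B hsB M (d.comp φ.toAddMonoidHom)
    (fun c => (congrArg d (hR c)).trans (hd0 _))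
    (fun x y => (congrArg d (φ.map_mul x y)).trans (hd _ _)) ⟨x, hsB hx⟩ hx
  rwa [show y = φ ⟨x, hsB hx⟩ from Subtype.ext hxy.symm]

end DifferentialCriterion

namespace TernaryTree

/-! ### Generating functions of sets of sized objects -/

/-- The generating function of the set `S` with respect to the size `w`. It is meaningful when only
finitely many elements have a given size; `Set.ncard` is `0` on infinite sets. -/
noncomputable def sizeGF {α : Type*} (w : α → ℕ) (S : Set α) : PowerSeries ℚ :=
  PowerSeries.mk fun n => ((S ∩ w ⁻¹' {n}).ncard : ℚ)

section sizeGF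
variable {α β : Type*} {w : α → ℕ} {v : β → ℕ}

theorem sizeGF_union (hw : ∀ n, (w ⁻¹' {n}).Finite) {S T : Set α} (h : Disjoint S T) :
    sizeGF w (S ∪ T) = sizeGF w S + sizeGF w T := by
  ext n
  simp only [sizeGF, PowerSeries.coeff_mk, map_add, Set.union_inter_distrib_right]
  rw [Set.ncard_union_eq (h.mono Set.inter_subset_left Set.inter_subset_left)
    ((hw n).subset Set.inter_subset_right) ((hw n).subset Set.inter_subset_right), Nat.cast_add]

theorem sizeGF_image {f : α → β} (hf : f.Injective) (hv : ∀ a, v (f a) = w a) (S : Set α) :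
    sizeGF v (f '' S) = sizeGF w S := by
  ext n
  simp only [sizeGF, PowerSeries.coeff_mk]
  rw [← Set.ncard_image_of_injective _ hf]
  congr 2
  ext b
  simp only [Set.mem_inter_iff, Set.mem_image, Set.mem_preimage, Set.mem_singleton_iff]
  constructor
  · rintro ⟨⟨a, ha, rfl⟩, hn⟩
    exact ⟨a, ⟨ha, hv a ▸ hn⟩, rfl⟩
  · rintro ⟨a, ⟨ha, hn⟩, rfl⟩
    exact ⟨⟨a, ha, rfl⟩, (hv a).trans hn⟩

theorem finite_preimage_add (hw : ∀ n, (w ⁻¹' {n}).Finite) (hv : ∀ n, (v ⁻¹' {n}).Finite) (n : ℕ) :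
    ((fun q : α × β => w q.1 + v q.2) ⁻¹' {n}).Finite := by
  refine ((Finset.HasAntidiagonal.antidiagonal n).finite_toSet.biUnion fun m _ =>
    (hw m.1).prod (hv m.2)).subset ?_
  rintro ⟨a, b⟩ h
  exact Set.mem_biUnion (x := (w a, v b)) (by simpa using h) (by simp)

theorem sizeGF_prod (hw : ∀ n, (w ⁻¹' {n}).Finite) (hv : ∀ n, (v ⁻¹' {n}).Finite)
    (S : Set α) (T : Set β) :
    sizeGF (fun q : α × β => w q.1 + v q.2) (S ×ˢ T) = sizeGF w S * sizeGF v T := by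
  ext n
  simp only [sizeGF, PowerSeries.coeff_mk, PowerSeries.coeff_mul, ← Nat.cast_mul,
    ← Nat.cast_sum, ← Set.ncard_prod]
  rw [← finsum_mem_coe_finset, ← (Finset.finite_toSet _).ncard_biUnion]
  · congr 2
    ext ⟨a, b⟩
    simp only [Set.mem_inter_iff, Set.mem_prod, Set.mem_preimage, Set.mem_singleton_iff,
      Set.mem_iUnion, SetLike.mem_coe, Finset.HasAntidiagonal.mem_antidiagonal,
      exists_prop, Prod.exists]
    constructor
    · rintro ⟨⟨ha, hb⟩, h⟩
      exact ⟨_, _, h, ⟨ha, rfl⟩, hb, rfl⟩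
    · rintro ⟨_, _, h, ⟨ha, rfl⟩, hb, rfl⟩
      exact ⟨⟨ha, hb⟩, h⟩
  · exact fun m _ => ((hw m.1).subset Set.inter_subset_right).prod
      ((hv m.2).subset Set.inter_subset_right)
  · rintro ⟨i, j⟩ - ⟨i', j'⟩ - hne
    refine Set.disjoint_left.mpr ?_
    rintro ⟨a, b⟩ ⟨⟨-, rfl⟩, -, rfl⟩ ⟨⟨-, rfl⟩, -, rfl⟩
    exact hne rfl
end sizeGF

/-! ### The equations between the generating functions -/

theorem finite_preimage_numLeaves (n : ℕ) : (numLeaves ⁻¹' {n}).Finite :=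
  (finite_numLeaves_le n).subset fun _ hT => le_of_eq hT

theorem rootGF_eq_sizeGF (t p : TernaryTree) :
    t.rootGF p = sizeGF numLeaves {T | T.Avoids t ∧ T.ContainsAtRoot p} := by
  ext n
  simp only [rootGF, sizeGF, AvRoot, PowerSeries.coeff_mk]
  congr 2
  ext T
  exact and_comm

theorem avoidGF_eq_rootGF_leaf (t : TernaryTree) : t.avoidGF = t.rootGF leaf := by
  ext n
  simp [avoidGF, rootGF, Av, AvRoot, ContainsAtRoot]

/-- This property of the intersection of patterns is the only one that the recurrence uses. -/
theorem containsAtRoot_inter (T s t : TernaryTree) :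
    T.ContainsAtRoot (s ∩ t) ↔ T.ContainsAtRoot s ∧ T.ContainsAtRoot t := by
  change T.ContainsAtRoot (s.inter t) ↔ _
  induction T generalizing s t with
  | leaf => cases s <;> cases t <;> simp [inter, ContainsAtRoot]
  | node l c r hl hc hr =>
    cases s <;> cases t <;> simp only [inter, ContainsAtRoot, true_and, and_true, hl, hc, hr]
    tauto

/-- A product of three generating functions counts the trees whose left, center and right subtrees
avoid `t` and contain the respective patterns at their roots. -/
theorem rootGF_mul (t p q r : TernaryTree) :
    t.rootGF p * t.rootGF q * t.rootGF r = sizeGF numLeaves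
      ((fun x : (TernaryTree × TernaryTree) × TernaryTree => node x.1.1 x.1.2 x.2) ''
        (({T | T.Avoids t ∧ T.ContainsAtRoot p} ×ˢ {T | T.Avoids t ∧ T.ContainsAtRoot q}) ×ˢ
          {T | T.Avoids t ∧ T.ContainsAtRoot r})) := by
  have hn := finite_preimage_numLeaves
  rw [sizeGF_image (w := fun x : (TernaryTree × TernaryTree) × TernaryTree =>
      (x.1.1.numLeaves + x.1.2.numLeaves) + x.2.numLeaves) ?_ fun _ => rfl]
  · rw [sizeGF_prod (w := fun x : TernaryTree × TernaryTree => x.1.numLeaves + x.2.numLeaves)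
      (finite_preimage_add hn hn) hn, sizeGF_prod hn hn]
    simp only [rootGF_eq_sizeGF]
  · rintro ⟨⟨a, b⟩, c⟩ ⟨⟨a', b'⟩, c'⟩ h
    simpa [and_assoc] using h

theorem avoids_node_iff {t : TernaryTree} (l c r : TernaryTree) :
    (node l c r).Avoids t ↔
      ¬(node l c r).ContainsAtRoot t ∧ l.Avoids t ∧ c.Avoids t ∧ r.Avoids t := by
  simp only [Avoids, Contains, not_or]

/-- The trees with all three subtrees avoiding `t` and containing `p.left`, `p.center`, `p.right` at
their roots are of two kinds: those that avoid `t`, and those that contain `t` at the root. The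
latter are counted by the product over the intersections. -/
theorem rootGF_recurrence {t p : TernaryTree} (ht : t ≠ leaf) (hp : p ≠ leaf) :
    t.rootGF p = t.rootGF p.left * t.rootGF p.center * t.rootGF p.right -
      t.rootGF (p.left ∩ t.left) * t.rootGF (p.center ∩ t.center) *
        t.rootGF (p.right ∩ t.right) := by
  rw [eq_sub_iff_add_eq, rootGF_mul, rootGF_mul, rootGF_eq_sizeGF,
    ← sizeGF_union finite_preimage_numLeaves]
  · obtain _ | ⟨t₁, t₂, t₃⟩ := t
    · contradiction
    obtain _ | ⟨p₁, p₂, p₃⟩ := p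
    · contradiction
    congr 1
    ext T
    obtain _ | ⟨l, c, r⟩ := T
    · simp [ContainsAtRoot]
    · simp only [Set.mem_union, Set.mem_ofPred_eq, avoids_node_iff, Set.mem_image, Set.mem_prod,
        Prod.exists, node.injEq, containsAtRoot_inter, ContainsAtRoot, left, center, right]
      constructor
      · rintro (h | ⟨a, b, c, h, rfl, rfl, rfl⟩)
        · exact ⟨l, c, r, by tauto, rfl, rfl, rfl⟩
        · exact ⟨_, _, _, by tauto, rfl, rfl, rfl⟩
      · rintro ⟨a, b, c, h, rfl, rfl, rfl⟩
        by_cases h' : (a.ContainsAtRoot t₁ ∧ b.ContainsAtRoot t₂ ∧ c.ContainsAtRoot t₃)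
        · exact Or.inr ⟨_, _, _, by tauto, rfl, rfl, rfl⟩
        · exact Or.inl (by tauto)
  · rw [Set.disjoint_left]
    rintro _ ⟨h, -⟩ ⟨⟨⟨a, b⟩, c⟩, h', rfl⟩
    obtain _ | ⟨t₁, t₂, t₃⟩ := t
    · contradiction
    simp only [avoids_node_iff, Set.mem_prod, Set.mem_ofPred_eq, containsAtRoot_inter,
      ContainsAtRoot, left, center, right] at h h'
    tauto

/-- The single vertex contributes `x`; all other trees contain the three-leaf tree at the root. -/
theorem rootGF_leaf {t : TernaryTree} (ht : t ≠ leaf) :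
    t.rootGF leaf = PowerSeries.X + t.rootGF threeLeaf := by
  have hX : (PowerSeries.X : PowerSeries ℚ) = sizeGF numLeaves {leaf} := by
    ext n
    simp only [PowerSeries.coeff_X, sizeGF, PowerSeries.coeff_mk]
    split_ifs with h
    · subst h
      rw [Set.inter_eq_left.mpr (by simp [numLeaves])]
      simp
    · rw [Set.disjoint_iff_inter_eq_empty.mp (by simpa [numLeaves] using Ne.symm h)]
      simp
  rw [hX, rootGF_eq_sizeGF, rootGF_eq_sizeGF, ← sizeGF_union finite_preimage_numLeaves]
  · congr 1
    ext T
    cases T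
    · cases t <;> simp_all [Avoids, Contains, ContainsAtRoot]
    · simp [ContainsAtRoot, threeLeaf]
  · simp [ContainsAtRoot, threeLeaf]

theorem constantCoeff_rootGF (t p : TernaryTree) : (t.rootGF p).constantCoeff = 0 := by
  rw [← PowerSeries.coeff_zero_eq_constantCoeff_apply, rootGF, PowerSeries.coeff_mk]
  have : AvRoot t p 0 = ∅ := Set.eq_empty_of_forall_notMem fun T hT =>
    (Nat.one_le_iff_ne_zero.mp T.one_le_numLeaves) hT.1
  simp [this]

theorem avoidGF_leaf : avoidGF leaf = 0 := by
  ext n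
  have h : ∀ T : TernaryTree, T.Contains leaf := fun T => by
    cases T <;> simp [Contains, ContainsAtRoot]
  simp [avoidGF, Av, Avoids, h]

/-! ### Algebraicity of the solution of a closed system -/

/-- The solution of a closed system is algebraic. Applied to the recurrence, whose right-hand side
is cubic in power series without constant term, a derivation `d` over `ℚ[x]` sends each `g_{(t;p)}`
into `𝔪 • N`, where `𝔪` is the maximal ideal of `ℚ⟦x⟧` and `N` is the span of the `d g_{(t;q)}`. So
`N = 0` by Nakayama's lemma, and the differential criterion applies. -/
theorem isAlgebraic_rootGF {t : TernaryTree} (ht : t ≠ leaf) {V : Finset TernaryTree}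
    (h₃ : threeLeaf ∈ V) (hV : ∀ p ∈ V, p ≠ leaf → t.successors p ⊆ V) :
    ∀ p ∈ V, IsAlgebraic (Polynomial ℚ) (t.rootGF p) := by
  classical
  have : FaithfulSMul (Polynomial ℚ) (PowerSeries ℚ) :=
    (faithfulSMul_iff_algebraMap_injective _ _).mpr (Polynomial.coe_injective ℚ)
  have key := isAlgebraic_of_forall_subalgebra_derivation_eq_zero (R := Polynomial ℚ)
    (V.image t.rootGF) ?_
  · exact fun p hp => key _ (Finset.mem_image_of_mem _ hp)
  intro B hB M _ _ d hd0 hd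
  have hmem : ∀ p ∈ V, t.rootGF p ∈ B := fun p hp => hB (Finset.mem_image_of_mem _ hp)
  let 𝔪 := IsLocalRing.maximalIdeal (PowerSeries ℚ)
  let N : Submodule (PowerSeries ℚ) M :=
    Submodule.span _ (d '' {x : B | (x : PowerSeries ℚ) ∈ V.image t.rootGF})
  have hg : ∀ p, t.rootGF p ∈ 𝔪 := fun p => by
    rw [IsLocalRing.mem_maximalIdeal, mem_nonunits_iff, PowerSeries.isUnit_iff_constantCoeff,
      constantCoeff_rootGF]
    exact not_isUnit_zero
  have hN : ∀ p (hp : p ∈ V), d ⟨t.rootGF p, hmem p hp⟩ ∈ N := fun p hp =>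
    Submodule.subset_span ⟨_, Finset.mem_image_of_mem t.rootGF hp, rfl⟩
  have hprod : ∀ p q r (hp : p ∈ V) (hq : q ∈ V) (hr : r ∈ V),
      d (⟨t.rootGF p, hmem p hp⟩ * ⟨t.rootGF q, hmem q hq⟩ * ⟨t.rootGF r, hmem r hr⟩) ∈ 𝔪 • N := by
    intro p q r hp hq hr
    rw [hd, hd]
    exact add_mem (Submodule.smul_mem_smul (𝔪.mul_mem_left _ (hg q)) (hN r hr))
      (Submodule.smul_mem _ _ (add_mem (Submodule.smul_mem_smul (hg p) (hN q hq))
        (Submodule.smul_mem_smul (hg q) (hN p hp))))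
  have hne : ∀ p (hp : p ∈ V), p ≠ leaf → d ⟨t.rootGF p, hmem p hp⟩ ∈ 𝔪 • N := by
    intro p hp hpl
    have hs := hV p hp hpl
    simp only [successors, Finset.insert_subset_iff, Finset.singleton_subset_iff] at hs
    obtain ⟨h1, h2, h3, h4, h5, h6⟩ := hs
    have := sub_mem (hprod _ _ _ h1 h2 h3) (hprod _ _ _ h4 h5 h6)
    rw [← map_sub] at this
    convert this using 2
    exact Subtype.ext (rootGF_recurrence ht hpl)
  have hall : ∀ p (hp : p ∈ V), d ⟨t.rootGF p, hmem p hp⟩ ∈ 𝔪 • N := by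
    intro p hp
    by_cases hpl : p = leaf
    · subst hpl
      -- The initial equation is linear, but it gives `d g_{(t;leaf)} = d g_{(t;threeLeaf)}`,
      -- to which the cubic case applies.
      have := hne _ h₃ (by simp [threeLeaf])
      rw [← zero_add (d _), ← hd0 Polynomial.X, ← map_add] at this
      convert this using 2
      refine Subtype.ext ((rootGF_leaf ht).trans ?_)
      simp [PowerSeries.algebraMap_apply']
    · exact hne p hp hpl
  have hfin : {x : B | (x : PowerSeries ℚ) ∈ V.image t.rootGF}.Finite :=
    (V.image t.rootGF).finite_toSet.preimage Subtype.val_injective.injOn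
  have hN0 : N = ⊥ := by
    refine Submodule.eq_bot_of_le_smul_of_le_jacobson_bot 𝔪 N
      (Submodule.fg_span (hfin.image d)) ?_ (IsLocalRing.maximalIdeal_le_jacobson _)
    refine Submodule.span_le.mpr ?_
    rintro _ ⟨⟨x, hx⟩, hxV, rfl⟩
    obtain ⟨p, hp, rfl⟩ := Finset.mem_image.mp hxV
    exact hall p hp
  intro x hx
  have : d x ∈ N := Submodule.subset_span ⟨x, hx, rfl⟩
  rwa [hN0, Submodule.mem_bot] at this

/-! ### Termination and completeness of the algorithm -/

/-- The number of edges on a longest path from the root to a leaf. -/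
def height : TernaryTree → ℕ
  | leaf => 0
  | node l c r => max l.height (max c.height r.height) + 1

theorem finite_height_le (n : ℕ) : {T : TernaryTree | T.height ≤ n}.Finite := by
  induction n with
  | zero =>
    refine (Set.finite_singleton leaf).subset fun T hT => ?_
    cases T <;> simp_all [height]
  | succ n ih =>
    refine ((Set.finite_singleton leaf).union
      ((ih.prod (ih.prod ih)).image fun q => node q.1 q.2.1 q.2.2)).subset fun T hT => ?_
    cases T with
    | leaf => exact Or.inl rfl
    | node l c r =>
      refine Or.inr ⟨(l, c, r), ?_, rfl⟩
      simp only [Set.mem_ofPred_eq, height] at hT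
      simp only [Set.mem_prod, Set.mem_ofPred_eq]
      omega

theorem height_inter (s t : TernaryTree) : (s ∩ t).height = max s.height t.height := by
  change (s.inter t).height = _
  induction s generalizing t with
  | leaf => simp [inter, height]
  | node l c r hl hc hr =>
    cases t
    · simp [inter, height]
    · simp only [inter, height, hl, hc, hr]
      omega

theorem height_le_of_mem_successors {t p q : TernaryTree} {n : ℕ} (ht : t.height ≤ n)
    (hp : p.height ≤ n) (hq : q ∈ t.successors p) : q.height ≤ n := by
  have h : ∀ s : TernaryTree, s.left.height ≤ s.height ∧ s.center.height ≤ s.height ∧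
      s.right.height ≤ s.height := by
    intro s
    cases s
    · simp [left, center, right]
    · simp only [left, center, right, height]
      omega
  have := h t
  have := h p
  simp only [successors, Finset.mem_insert, Finset.mem_singleton] at hq
  obtain rfl | rfl | rfl | rfl | rfl | rfl := hq <;>
    try simp only [height_inter]
  all_goals omega

/-- The properties of a state that every round of the algorithm preserves: each treated pattern has
its equation, the patterns introduced by these equations are treated or waiting in `P`, and no
pattern is higher than `max 1 t.height`. -/
structure Invariant (t : TernaryTree) (S : AlgState) : Prop where
  leaf_mem : leaf ∈ S.Var
  threeLeaf_mem : threeLeaf ∈ S.Var ∪ S.P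
  disjoint : Disjoint S.P S.Var
  initial_mem : initialEquation ∈ S.Eq
  recurrence_mem : ∀ p ∈ S.Var, p ≠ leaf → t.recurrenceEquation p ∈ S.Eq
  successors_subset : ∀ p ∈ S.Var, p ≠ leaf → t.successors p ⊆ S.Var ∪ S.P
  eq_or : ∀ e ∈ S.Eq, e = initialEquation ∨ ∃ p ∈ S.Var, p ≠ leaf ∧ e = t.recurrenceEquation p
  height_le : ∀ p ∈ S.Var ∪ S.P, p.height ≤ max 1 t.height

/-- In the initial state the only pattern in `P` has height `1`, whence the `1` in `max 1 t.height`. -/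
theorem invariant_initState (t : TernaryTree) : t.Invariant initState where
  leaf_mem := by simp [initState]
  threeLeaf_mem := by simp [initState]
  disjoint := by simp [initState, threeLeaf]
  initial_mem := by simp [initState]
  recurrence_mem := by simp [initState]
  successors_subset := by simp [initState]
  eq_or := by simp [initState]
  height_le := by simp [initState, height, threeLeaf]

theorem Invariant.step {t : TernaryTree} {S : AlgState} (h : t.Invariant S) :
    t.Invariant (t.step S) := by
  have hP : ∀ p ∈ S.P, p ≠ leaf := fun p hp hl =>
    Finset.disjoint_left.mp h.disjoint hp (hl ▸ h.leaf_mem)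
  have hU : (t.step S).Var ∪ (t.step S).P = S.Var ∪ S.P ∪ S.P.biUnion (successors t) :=
    Finset.union_sdiff_self_eq_union
  refine ⟨?_, ?_, Finset.sdiff_disjoint, ?_, ?_, ?_, ?_, ?_⟩
  · exact Finset.mem_union_left _ h.leaf_mem
  · exact Finset.mem_union_left _ h.threeLeaf_mem
  · exact Finset.mem_union_left _ h.initial_mem
  · intro p hp hl
    obtain hp | hp := Finset.mem_union.mp hp
    · exact Finset.mem_union_left _ (h.recurrence_mem p hp hl)
    · exact Finset.mem_union_right _ (Finset.mem_image_of_mem _ hp)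
  · intro p hp hl
    rw [hU]
    obtain hp | hp := Finset.mem_union.mp hp
    · exact (h.successors_subset p hp hl).trans Finset.subset_union_left
    · exact (Finset.subset_biUnion_of_mem _ hp).trans Finset.subset_union_right
  · intro e he
    obtain he | he := Finset.mem_union.mp he
    · exact (h.eq_or e he).imp_right fun ⟨p, hp, hpe⟩ => ⟨p, Finset.mem_union_left _ hp, hpe⟩
    · obtain ⟨p, hp, rfl⟩ := Finset.mem_image.mp he
      exact Or.inr ⟨p, Finset.mem_union_right _ hp, hP p hp, rfl⟩
  · intro q hq
    rw [hU] at hq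
    obtain hq | hq := Finset.mem_union.mp hq
    · exact h.height_le q hq
    · obtain ⟨p, hp, hq⟩ := Finset.mem_biUnion.mp hq
      exact height_le_of_mem_successors (le_max_right _ _)
        (h.height_le p (Finset.mem_union_right _ hp)) hq

theorem stateAfter_succ (t : TernaryTree) (k : ℕ) :
    t.stateAfter (k + 1) = t.step (t.stateAfter k) :=
  Function.iterate_succ_apply' _ _ _

theorem invariant_stateAfter (t : TernaryTree) (k : ℕ) : t.Invariant (t.stateAfter k) := by
  induction k with
  | zero => exact t.invariant_initState
  | succ k ih => exact stateAfter_succ t k ▸ ih.step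

/-- A round with nonempty `P` enlarges `Var`, which stays inside the finite set of patterns of
bounded height. -/
theorem exists_stateAfter_P_eq_empty (t : TernaryTree) : ∃ k, (t.stateAfter k).P = ∅ := by
  by_contra! hP
  have hmono : StrictMono fun k => (t.stateAfter k).Var.card := by
    refine strictMono_nat_of_lt_succ fun k => ?_
    rw [stateAfter_succ]
    change _ < (_ ∪ _ : Finset _).card
    rw [Finset.card_union_of_disjoint (t.invariant_stateAfter k).disjoint.symm]
    exact Nat.lt_add_of_pos_right (Finset.card_pos.mpr (hP k))
  let F := (finite_height_le (max 1 t.height)).toFinset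
  have hle : (t.stateAfter (F.card + 1)).Var.card ≤ F.card := Finset.card_le_card fun p hp =>
    (Set.Finite.mem_toFinset _).mpr
      ((t.invariant_stateAfter _).height_le p (Finset.mem_union_left _ hp))
  have := hmono.id_le (F.card + 1)
  simp only [id] at this
  omega

/-! ### Degree, unknowns and values of the equations -/

theorem totalDegree_unknown (p : TernaryTree) : (unknown p).totalDegree = 1 :=
  MvPolynomial.totalDegree_X _

theorem totalDegree_unknown_mul_le (p q r : TernaryTree) :
    (unknown p * unknown q * unknown r).totalDegree ≤ 3 := by
  have h1 := MvPolynomial.totalDegree_mul (unknown p * unknown q) (unknown r)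
  have h2 := MvPolynomial.totalDegree_mul (unknown p) (unknown q)
  simp only [totalDegree_unknown] at h1 h2
  omega

theorem totalDegree_initialEquation_le : initialEquation.totalDegree ≤ 3 := by
  refine (MvPolynomial.totalDegree_sub _ _).trans (max_le ?_
    ((MvPolynomial.totalDegree_add _ _).trans (max_le ?_ ?_)))
  all_goals simp [unknown, MvPolynomial.totalDegree_X]

theorem totalDegree_recurrenceEquation_le (t p : TernaryTree) :
    (t.recurrenceEquation p).totalDegree ≤ 3 :=
  (MvPolynomial.totalDegree_sub _ _).trans (max_le (by simp [totalDegree_unknown])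
    ((MvPolynomial.totalDegree_sub _ _).trans
      (max_le (totalDegree_unknown_mul_le _ _ _) (totalDegree_unknown_mul_le _ _ _))))

theorem eq_of_mem_vars_initialEquation {q : TernaryTree} (hq : some q ∈ initialEquation.vars) :
    q = leaf ∨ q = threeLeaf := by
  have := MvPolynomial.vars_sub_subset (p := unknown leaf) hq
  have h : some q ∈ (unknown leaf).vars ∪
      ((MvPolynomial.X none : SystemPoly).vars ∪ (unknown threeLeaf).vars) :=
    Finset.union_subset_union_right (MvPolynomial.vars_add_subset _ _) this
  simpa [unknown, MvPolynomial.vars_X] using h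

theorem mem_of_mem_vars_unknown_mul {p q r s : TernaryTree}
    (hs : some s ∈ (unknown p * unknown q * unknown r).vars) : s = p ∨ s = q ∨ s = r := by
  have h : some s ∈ ((unknown p).vars ∪ (unknown q).vars) ∪ (unknown r).vars :=
    Finset.union_subset_union_left (MvPolynomial.vars_mul _ _) (MvPolynomial.vars_mul _ _ hs)
  simpa [unknown, MvPolynomial.vars_X, or_assoc] using h

theorem mem_of_mem_vars_recurrenceEquation {t p q : TernaryTree}
    (hq : some q ∈ (t.recurrenceEquation p).vars) : q = p ∨ q ∈ t.successors p := by
  obtain h | h := Finset.mem_union.mp (MvPolynomial.vars_sub_subset _ hq)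
  · exact Or.inl (by simpa [unknown, MvPolynomial.vars_X] using h)
  · right
    obtain h | h := Finset.mem_union.mp (MvPolynomial.vars_sub_subset _ h) <;>
    obtain rfl | rfl | rfl := mem_of_mem_vars_unknown_mul h <;> simp [successors]

theorem aeval_initialEquation {t : TernaryTree} (ht : t ≠ leaf) :
    MvPolynomial.aeval t.systemValue initialEquation = 0 := by
  simp [initialEquation, unknown, systemValue, rootGF_leaf ht]

theorem aeval_recurrenceEquation {t p : TernaryTree} (ht : t ≠ leaf) (hp : p ≠ leaf) :
    MvPolynomial.aeval t.systemValue (t.recurrenceEquation p) = 0 := by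
  simp [recurrenceEquation, unknown, systemValue, ← rootGF_recurrence ht hp]

end TernaryTree

theorem mainTheorem6 (t : TernaryTree) :
    (t ≠ TernaryTree.leaf →
      -- the initial equation
      (t.avoidGF = t.rootGF TernaryTree.leaf ∧
        t.avoidGF = PowerSeries.X + t.rootGF TernaryTree.threeLeaf) ∧
      -- the recurrence for every nontrivial root pattern
      (∀ p : TernaryTree, p ≠ TernaryTree.leaf →
        t.rootGF p =
          t.rootGF p.left * t.rootGF p.center * t.rootGF p.right -
            t.rootGF (p.left ∩ t.left) * t.rootGF (p.center ∩ t.center) *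
              t.rootGF (p.right ∩ t.right)) ∧
      -- the algorithm stops with a complete finite system of degree at most 3,
      -- which the generating functions satisfy
      (∃ k : ℕ, (t.stateAfter k).P = ∅ ∧
        TernaryTree.leaf ∈ (t.stateAfter k).Var ∧
        TernaryTree.initialEquation ∈ (t.stateAfter k).Eq ∧
        (∀ p ∈ (t.stateAfter k).Var, p ≠ TernaryTree.leaf →
          t.recurrenceEquation p ∈ (t.stateAfter k).Eq) ∧
        ∀ e ∈ (t.stateAfter k).Eq,
          (∀ p : TernaryTree, some p ∈ e.vars → p ∈ (t.stateAfter k).Var) ∧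
          e.totalDegree ≤ 3 ∧
          MvPolynomial.aeval t.systemValue e = 0)) ∧
    -- algebraicity
    IsAlgebraic (Polynomial ℚ) t.avoidGF := by
  obtain ⟨k, hk⟩ := t.exists_stateAfter_P_eq_empty
  have hI := t.invariant_stateAfter k
  have h₃ := hI.threeLeaf_mem
  have hsucc := hI.successors_subset
  rw [hk, Finset.union_empty] at h₃ hsucc
  refine ⟨fun ht => ⟨⟨t.avoidGF_eq_rootGF_leaf,
    t.avoidGF_eq_rootGF_leaf.trans (TernaryTree.rootGF_leaf ht)⟩,
    fun p hp => TernaryTree.rootGF_recurrence ht hp,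
    k, hk, hI.leaf_mem, hI.initial_mem, hI.recurrence_mem, fun e he => ?_⟩, ?_⟩
  · obtain rfl | ⟨p, hp, hpl, rfl⟩ := hI.eq_or e he
    · refine ⟨fun q hq => ?_, TernaryTree.totalDegree_initialEquation_le,
        TernaryTree.aeval_initialEquation ht⟩
      obtain rfl | rfl := TernaryTree.eq_of_mem_vars_initialEquation hq
      exacts [hI.leaf_mem, h₃]
    · refine ⟨fun q hq => ?_, TernaryTree.totalDegree_recurrenceEquation_le t p,
        TernaryTree.aeval_recurrenceEquation ht hpl⟩
      obtain rfl | h := TernaryTree.mem_of_mem_vars_recurrenceEquation hq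
      exacts [hp, hsucc p hp hpl h]
  · by_cases ht : t = TernaryTree.leaf
    · rw [ht, TernaryTree.avoidGF_leaf]
      exact isAlgebraic_zero
    · rw [t.avoidGF_eq_rootGF_leaf]
      exact TernaryTree.isAlgebraic_rootGF ht h₃ hsucc _ hI.leaf_mem
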